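/- **Setting.** Let $(\mathcal U,g)$ be a smooth $(m+1)$-dimensional Lorentzian manifold, $g$ of signature $(-,+,\dots,+)$, let $\Phi:\mathcal U\to\mathbb R$ be smooth with $d\Phi\neq0$ on $\Phi^{-1}(0)$, and let $M=\Phi^{-1}(0)$ with its structure of embedded hypersurface. Let $g^M$ be the restriction of $g$ to $TM$ and assume that it has constant corank $k\ge1$, so that $\mathcal N=\ker g^M\subset TM$ is a distribution of rank $k$. Let $\mathcal S\subset TM$ be a smooth distribution with $TM=\mathcal N\oplus\mathcal S$. Let $\mathcal V=\mathcal V_{\mathcal N}+\mathcal V_{\mathcal S}$ be a $C^2$ vector field on $M$, decomposed accordingly. A subset of $M$ is called *bounded* if it is covered by finitely many balls of finite radius for the pseudo-distance of $g^M$, i.e. the infimum of the $g^M$-lengths $\int\sqrt{g^M(\dot\gamma,\dot\gamma)}\,dt$ of $C^1$ curves in $M$ joining two points ($\infty$ if there is none); one ball suffices if $M$ is connected. **Theorem.** Suppose that: 1. $\mathcal V$ generates a continuous closed semiflow on $M$: there are maps $(t,X_0)\mapsto X(t;X_0)$, $t\ge0$, jointly continuous, with $X(0;X_0)=X_0$,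 $X(s+t;X_0)=X(s;X(t;X_0))$ and $\dot X=\mathcal V(X)$, and $x_j\to x$, $X(t;x_j)\to y$ imply $y=X(t;x)$. 2. $\mathcal N$ is involutive, $[\mathcal V,W]\in\Gamma(\mathcal N)$ for every smooth section $W\in\Gamma(\mathcal N)$, and the leaves of the foliation $\mathscr F$ integrating $\mathcal N$ are compact and embedded. 3. The leaf space $M_{\mathrm{red}}=M/\mathscr F$ is a Hausdorff smooth manifold for which the projection $\pi:M\to M_{\mathrm{red}}$ is a smooth submersion, $g^M$ descends to a smooth Riemannian metric $g_{\mathrm{red}}$ on $M_{\mathrm{red}}$ (that is, $\pi^*g_{\mathrm{red}}=g^M$), and $(M_{\mathrm{red}},g_{\mathrm{red}})$ is complete. 4. There is a $C^1$ function $\Psi:M\to\mathbb R$, bounded below, all of whose sublevel sets $\{\Psi\le a\}$ are bounded, such that $d\Psi$ vanishes on $\mathcal N$ and, for some $c>0$, $d\Psi(\mathcal V_{\mathcal S})\le -c\,g^M(\mathcal V_{\mathcal S},\mathcal V_{\mathcal S})$ on $M$. Then the evolution is asymptotically compact: for every bounded sequence $(X_j)$ in $M$ and every sequence $t_j\to\infty$,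 the sequence $X(t_j;X_j)$ has a subsequence that converges in $M$. -/

import Mathlib

open Set Filter Topology MeasureTheory Bundle Manifold
open scoped Manifold ContDiff ENNReal NNReal

noncomputable section

/-- `ℝⁿ`, the model space of `n`-dimensional manifolds. -/
abbrev Eu (n : ℕ) : Type := EuclideanSpace ℝ (Fin n)

/-! ### Curves, distributions and leaves on a manifold -/

section Foliation

variable {m : ℕ} {M : Type*} [TopologicalSpace M] [ChartedSpace (Eu m) M]

/-- The velocity of a curve parametrised by `[0, 1]`. -/
def velocity (m : ℕ) {M : Type*} [TopologicalSpace M] [ChartedSpace (Eu m) M]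
    (γ : ℝ → M) (t : ℝ) : TangentSpace (𝓡 m) (γ t) :=
  mfderivWithin 𝓘(ℝ, ℝ) (𝓡 m) γ (Icc 0 1) t (1 : ℝ)

/-- `γ` is a `C¹` curve `[0, 1] → M` from `x` to `y` (values off `[0, 1]` are irrelevant). -/
structure IsC1Curve (m : ℕ) {M : Type*} [TopologicalSpace M] [ChartedSpace (Eu m) M]
    (γ : ℝ → M) (x y : M) : Prop where
  contMDiffOn : ContMDiffOn 𝓘(ℝ, ℝ) (𝓡 m) 1 γ (Icc 0 1)
  source : γ 0 = x
  target : γ 1 = y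

/-- A vector field of class `C^n`. -/
def IsVectorFieldOfClass [IsManifold (𝓡 m) ∞ M] (n : ℕ∞ω)
    (W : ∀ x : M, TangentSpace (𝓡 m) x) : Prop :=
  ContMDiff (𝓡 m) (𝓡 m).tangent n (fun x => (⟨x, W x⟩ : TangentBundle (𝓡 m) M))

/-- `W` is a smooth section of the distribution `D`. -/
def IsSmoothSection [IsManifold (𝓡 m) ∞ M] (D : ∀ x : M, Submodule ℝ (TangentSpace (𝓡 m) x))
    (W : ∀ x : M, TangentSpace (𝓡 m) x) : Prop :=
  IsVectorFieldOfClass ∞ W ∧ ∀ x, W x ∈ D x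

/-- Smoothness of a distribution: every vector of `D` is a value of a smooth section of `D`.
For distributions of constant rank this says that `D` is a smooth subbundle of `TM`. -/
def IsSmoothDistribution [IsManifold (𝓡 m) ∞ M]
    (D : ∀ x : M, Submodule ℝ (TangentSpace (𝓡 m) x)) : Prop :=
  ∀ x, ∀ v ∈ D x, ∃ W, IsSmoothSection D W ∧ W x = v

/-- `[W₁, W₂] ∈ Γ(D)` for all `W₁, W₂ ∈ Γ(D)`. -/
def IsInvolutive [IsManifold (𝓡 m) ∞ M]
    (D : ∀ x : M, Submodule ℝ (TangentSpace (𝓡 m) x)) : Prop :=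
  ∀ W₁ W₂, IsSmoothSection D W₁ → IsSmoothSection D W₂ →
    ∀ x, VectorField.mlieBracket (𝓡 m) W₁ W₂ x ∈ D x

/-- `[V, W] ∈ Γ(D)` for all `W ∈ Γ(D)`. -/
def PreservesDistribution [IsManifold (𝓡 m) ∞ M] (V : ∀ x : M, TangentSpace (𝓡 m) x)
    (D : ∀ x : M, Submodule ℝ (TangentSpace (𝓡 m) x)) : Prop :=
  ∀ W, IsSmoothSection D W → ∀ x, VectorField.mlieBracket (𝓡 m) V W x ∈ D x

/-- `x` and `y` are joined by a `C¹` curve that is everywhere tangent to `D`. -/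
def TangentArc (D : ∀ x : M, Submodule ℝ (TangentSpace (𝓡 m) x)) (x y : M) : Prop :=
  ∃ γ : ℝ → M, IsC1Curve m γ x y ∧ ∀ t ∈ Icc (0 : ℝ) 1, velocity m γ t ∈ D (γ t)

/-- Two points lie on the same leaf if a finite concatenation of `C¹` arcs tangent to `D` joins
them. For an involutive distribution of constant rank the classes are the leaves of the foliation
that integrates `D`. -/
def leafSetoid (D : ∀ x : M, Submodule ℝ (TangentSpace (𝓡 m) x)) : Setoid M :=
  Relation.EqvGen.setoid (TangentArc D)

/-- The leaf through `x`. -/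
def leaf (D : ∀ x : M, Submodule ℝ (TangentSpace (𝓡 m) x)) (x : M) : Set M :=
  {y | (leafSetoid D) x y}

/-- The space of leaves `M / 𝓕`, with the quotient topology. -/
def LeafSpace (D : ∀ x : M, Submodule ℝ (TangentSpace (𝓡 m) x)) : Type _ :=
  Quotient (leafSetoid D)

instance (D : ∀ x : M, Submodule ℝ (TangentSpace (𝓡 m) x)) : TopologicalSpace (LeafSpace D) :=
  inferInstanceAs (TopologicalSpace (Quotient (leafSetoid D)))

/-- The canonical projection `π : M → M / 𝓕`. -/
def leafProj (D : ∀ x : M, Submodule ℝ (TangentSpace (𝓡 m) x)) (x : M) : LeafSpace D :=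
  Quotient.mk (leafSetoid D) x

end Foliation

/-! ### Lorentzian phase spaces and constraint hypersurfaces -/

/-- A smooth Lorentzian metric, of signature `(-, +, …, +)`, on a manifold of dimension
`m + 1`. -/
structure LorentzianMetric (m : ℕ) (U : Type*) [TopologicalSpace U]
    [ChartedSpace (Eu (m + 1)) U] [IsManifold (𝓡 (m + 1)) ∞ U] where
  /-- The bilinear form on the tangent spaces. -/
  form (x : U) : TangentSpace (𝓡 (m + 1)) x →L[ℝ] TangentSpace (𝓡 (m + 1)) x →L[ℝ] ℝ
  symm (x : U) (v w : TangentSpace (𝓡 (m + 1)) x) : form x v w = form x w v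
  signature (x : U) : ∃ e : Module.Basis (Fin (m + 1)) ℝ (TangentSpace (𝓡 (m + 1)) x),
    ∀ i j, form x (e i) (e j) = if i = j then (if i = 0 then -1 else 1) else 0
  contMDiff : ContMDiff (𝓡 (m + 1))
    ((𝓡 (m + 1)).prod 𝓘(ℝ, Eu (m + 1) →L[ℝ] Eu (m + 1) →L[ℝ] ℝ)) ∞
    (fun x => TotalSpace.mk' (Eu (m + 1) →L[ℝ] Eu (m + 1) →L[ℝ] ℝ)
      (E := fun x : U =>
        TangentSpace (𝓡 (m + 1)) x →L[ℝ] TangentSpace (𝓡 (m + 1)) x →L[ℝ] ℝ) x (form x))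

/-- The level set `Φ⁻¹(0)` with the subspace topology. -/
abbrev Hypersurface {U : Type*} (Φ : U → ℝ) : Type _ := {x : U // Φ x = 0}

section Constraint

variable {m : ℕ} {U : Type*} [TopologicalSpace U] [ChartedSpace (Eu (m + 1)) U]
  [IsManifold (𝓡 (m + 1)) ∞ U] (g : LorentzianMetric m U) (Φ : U → ℝ)
  [ChartedSpace (Eu m) (Hypersurface Φ)]

/-- The restriction `g^M` of `g` to the tangent spaces of `M = Φ⁻¹(0)`. -/
def inducedForm (x : Hypersurface Φ) (v w : TangentSpace (𝓡 m) x) : ℝ :=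
  g.form x (mfderiv (𝓡 m) (𝓡 (m + 1)) (Subtype.val : Hypersurface Φ → U) x v)
    (mfderiv (𝓡 m) (𝓡 (m + 1)) (Subtype.val : Hypersurface Φ → U) x w)

/-- The null distribution `N = ker g^M`. -/
def nullDistribution (x : Hypersurface Φ) : Submodule ℝ (TangentSpace (𝓡 m) x) where
  carrier := {v | ∀ w, inducedForm g Φ x v w = 0}
  add_mem' {a b} ha hb w := by
    have ha' := ha w
    have hb' := hb w
    simp only [inducedForm] at ha' hb' ⊢
    rw [map_add, map_add, _root_.add_apply, ha', hb', add_zero]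
  zero_mem' w := by
    simp only [inducedForm]
    rw [map_zero, map_zero, _root_.zero_apply]
  smul_mem' c a ha w := by
    have ha' := ha w
    simp only [inducedForm] at ha' ⊢
    rw [map_smul, map_smul, _root_.smul_apply, ha', smul_zero]

/-- The reduced space `M_red = M / 𝓕`, the leaf space of the null distribution. -/
abbrev ReducedSpace : Type _ := LeafSpace (nullDistribution g Φ)

/-- The `g^M`-length of a curve `[0, 1] → M`. -/
def inducedLength (γ : ℝ → Hypersurface Φ) : ℝ≥0∞ :=
  ∫⁻ t in Icc (0 : ℝ) 1,
    ENNReal.ofReal (√(inducedForm g Φ (γ t) (velocity m γ t) (velocity m γ t)))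

/-- The pseudo-distance of `g^M`: the infimum of the `g^M`-lengths of `C¹` curves in `M` from `x`
to `y`. It is `∞` between different components and `0` along a leaf. -/
def inducedEDist (x y : Hypersurface Φ) : ℝ≥0∞ :=
  ⨅ (γ : ℝ → Hypersurface Φ) (_ : IsC1Curve m γ x y), inducedLength g Φ γ

/-- Bounded subsets of `M`: those covered by finitely many balls of finite radius for the
pseudo-distance of `g^M`. (One ball is enough if `M` is connected.) -/
def IsBoundedSet (s : Set (Hypersurface Φ)) : Prop :=
  ∃ (F : Finset (Hypersurface Φ)) (R : ℝ≥0), ∀ x ∈ s, ∃ p ∈ F, inducedEDist g Φ p x ≤ R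

variable [IsManifold (𝓡 m) ∞ (Hypersurface Φ)]

/-- `S` is a smooth distribution complementary to `N`, i.e. `TM = N ⊕ S`. -/
structure IsTransversalComplement
    (S : ∀ x : Hypersurface Φ, Submodule ℝ (TangentSpace (𝓡 m) x)) : Prop where
  smooth : IsSmoothDistribution S
  isCompl (x : Hypersurface Φ) : IsCompl (S x) (nullDistribution g Φ x)

variable {g Φ} in
/-- The transversal part `V_S` in the decomposition `V = V_N + V_S`. -/
def transversalPart {S : ∀ x : Hypersurface Φ, Submodule ℝ (TangentSpace (𝓡 m) x)}
    (hS : IsTransversalComplement g Φ S) (V : ∀ x : Hypersurface Φ, TangentSpace (𝓡 m) x)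
    (x : Hypersurface Φ) : TangentSpace (𝓡 m) x :=
  (Submodule.projectionOnto (S x) (nullDistribution g Φ x) (hS.isCompl x) (V x) : S x)

/-- The differential `dΨ(v)` of a real function at `x`, as a real number. -/
def differential {m : ℕ} {M : Type*} [TopologicalSpace M] [ChartedSpace (Eu m) M]
    (Ψ : M → ℝ) (x : M) (v : TangentSpace (𝓡 m) x) : ℝ :=
  mfderiv (𝓡 m) 𝓘(ℝ, ℝ) Ψ x v

variable {g Φ} in
/-- `Ψ` is a proper null-compatible functional with transversal dissipation for `V`. -/
structure IsDissipativeFunctional {S : ∀ x : Hypersurface Φ, Submodule ℝ (TangentSpace (𝓡 m) x)}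
    (hS : IsTransversalComplement g Φ S) (V : ∀ x : Hypersurface Φ, TangentSpace (𝓡 m) x)
    (Ψ : Hypersurface Φ → ℝ) : Prop where
  contMDiff : ContMDiff (𝓡 m) 𝓘(ℝ, ℝ) 1 Ψ
  bddBelow : BddBelow (range Ψ)
  /-- `dΨ` vanishes on `N`. -/
  compatible (x : Hypersurface Φ) (v : TangentSpace (𝓡 m) x) (hv : v ∈ nullDistribution g Φ x) :
    differential Ψ x v = 0
  /-- `dΨ(V_S) ≤ -c ‖V_S‖²`, with `‖·‖` the norm of `g^M` on `S`. -/
  dissipation : ∃ c : ℝ, 0 < c ∧ ∀ x : Hypersurface Φ,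
    differential Ψ x (transversalPart hS V x) ≤
      -(c * inducedForm g Φ x (transversalPart hS V x) (transversalPart hS V x))
  /-- All sublevel sets are bounded. -/
  proper (a : ℝ) : IsBoundedSet g Φ {x | Ψ x ≤ a}

end Constraint

/-! ### Semiflows -/

/-- `φ t x`, `t ≥ 0`, is a continuous closed semiflow on `M` generated by the vector field `V`.
Values at negative times are irrelevant. -/
structure IsClosedSemiflow {m : ℕ} {M : Type*} [TopologicalSpace M] [ChartedSpace (Eu m) M]
    (V : ∀ x : M, TangentSpace (𝓡 m) x) (φ : ℝ → M → M) : Prop where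
  map_zero (x : M) : φ 0 x = x
  map_add (s t : ℝ) (hs : 0 ≤ s) (ht : 0 ≤ t) (x : M) : φ (s + t) x = φ s (φ t x)
  continuousOn : ContinuousOn (fun p : ℝ × M => φ p.1 p.2) (Ici 0 ×ˢ univ)
  /-- `x_k → x` and `φ_t(x_k) → y` imply `y = φ_t(x)`. -/
  closed (t : ℝ) (ht : 0 ≤ t) (u : ℕ → M) (x y : M) (hu : Tendsto u atTop (𝓝 x))
    (hy : Tendsto (fun k => φ t (u k)) atTop (𝓝 y)) : y = φ t x
  /-- Every trajectory solves `Ẋ = V(X)` on `[0, ∞)`. -/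
  integralCurve (x : M) : IsMIntegralCurveOn (I := 𝓡 m) (fun t => φ t x) V (Ici 0)

/-- Asymptotic compactness: for every bounded sequence `X_k` and all `t_k → ∞`, the sequence
`φ_{t_k}(X_k)` has a convergent subsequence. -/
def IsAsymptoticallyCompact {M : Type*} [TopologicalSpace M] (bounded : Set M → Prop)
    (φ : ℝ → M → M) : Prop :=
  ∀ (X : ℕ → M) (t : ℕ → ℝ), bounded (range X) → Tendsto t atTop atTop →
    ∃ (σ : ℕ → ℕ) (Y : M), StrictMono σ ∧
      Tendsto (fun k => φ (t (σ k)) (X (σ k))) atTop (𝓝 Y)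

/-! ### Completeness of a Riemannian manifold -/

/-- Metric completeness for the Riemannian distance (the infimum of lengths of `C¹` curves):
every Cauchy sequence converges. -/
def IsRiemannianComplete (q : ℕ) (B : Type*) [TopologicalSpace B] [ChartedSpace (Eu q) B]
    [RiemannianBundle (fun b : B => TangentSpace (𝓡 q) b)] : Prop :=
  ∀ u : ℕ → B,
    (∀ ε : ℝ≥0∞, 0 < ε → ∃ K, ∀ i ≥ K, ∀ j ≥ K, riemannianEDist (𝓡 q) (u i) (u j) < ε) →
    ∃ b, Tendsto u atTop (𝓝 b)

end

/-!
Since `V - V_S` is null and `dΨ` kills null vectors, `dΨ(V) = dΨ(V_S) ≤ 0`: the functional does not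
increase along trajectories. Once bounded sets are known to be relatively compact, `Ψ ≤ a` on a
given bounded set for some `a`, and its points then stay in the relatively compact set `{Ψ ≤ a}`.
For the compactness, the projection `π` to the leaf space does not increase distances, and by
Hopf–Rinow the closed balls of the complete manifold `M_red` are compact. Finally `π` is proper,
because a quotient map with compact connected fibres is: if a fibre lies in the interior of a
compact set `L`, then nearby fibres miss the frontier of `L`, hence stay in `L` by connectedness.
-/

section LengthSpace

open Metric

theorem totallyBounded_of_forall_subset_thickening {X : Type*} [PseudoEMetricSpace X] {s : Set X}
    (h : ∀ δ : ℝ, 0 < δ → ∃ t, TotallyBounded t ∧ s ⊆ thickening δ t) : TotallyBounded s := by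
  refine EMetric.totallyBounded_iff.2 fun ε hε => ?_
  obtain ⟨η, hη, hηε⟩ := ENNReal.lt_iff_exists_nnreal_btwn.1 (ENNReal.half_pos hε.ne')
  obtain ⟨t, ht, hst⟩ := h η (by exact_mod_cast hη)
  obtain ⟨c, hc, htc⟩ := EMetric.totallyBounded_iff.1 ht η hη
  refine ⟨c, hc, fun x hx => ?_⟩
  obtain ⟨z, hz, hxz⟩ := (mem_thickening_iff_exists_edist_lt _ _).1 (hst hx)
  obtain ⟨y, hy, hzy⟩ := mem_iUnion₂.1 (htc hz)
  rw [ENNReal.ofReal_coe_nnreal] at hxz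
  refine mem_iUnion₂.2 ⟨y, hy, ?_⟩
  calc edist x y ≤ edist x z + edist z y := edist_triangle _ _ _
    _ < η + η := ENNReal.add_lt_add hxz hzy
    _ ≤ ε / 2 + ε / 2 := by gcongr
    _ = ε := ENNReal.add_halves ε

/-- Length spaces, the setting of the Hopf–Rinow theorem. The condition is expressed through
approximate intermediate points instead of lengths of curves; for complete spaces this is
equivalent to the usual definition. -/
def IsLengthSpace (X : Type*) [PseudoEMetricSpace X] : Prop :=
  ∀ (x y : X) (r s : ℝ≥0∞), 0 < s → edist x y < r + s → ∃ z, edist x z ≤ r ∧ edist z y < s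

namespace IsLengthSpace

variable {X : Type*} [PseudoEMetricSpace X]

theorem eball_add_subset_thickening (hX : IsLengthSpace X) (p : X) (r : ℝ≥0∞) {δ : ℝ}
    (hδ : 0 < δ) : eball p (r + ENNReal.ofReal δ) ⊆ thickening δ (closedEBall p r) := by
  intro x hx
  obtain ⟨z, hpz, hzx⟩ := hX p x r _ (ENNReal.ofReal_pos.2 hδ) (mem_eball'.1 hx)
  exact (mem_thickening_iff_exists_edist_lt _ _).2 ⟨z, mem_closedEBall'.2 hpz, by rwa [edist_comm]⟩

theorem closedEBall_subset_thickening (hX : IsLengthSpace X) (p : X) {r s δ : ℝ≥0}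
    (hδ : 0 < δ) (h : r < s + δ) : closedEBall p r ⊆ thickening δ (closedEBall p s) := by
  have hlt : (r : ℝ≥0∞) < s + ENNReal.ofReal δ := by
    rw [ENNReal.ofReal_coe_nnreal]
    exact_mod_cast h
  exact fun _ hx => hX.eball_add_subset_thickening p s hδ (lt_of_le_of_lt hx hlt)

theorem exists_gt_isCompact_closedEBall [LocallyCompactSpace X] (hX : IsLengthSpace X) {p : X}
    {r : ℝ≥0} (hr : IsCompact (closedEBall p (r : ℝ≥0∞))) :
    ∃ s > r, IsCompact (closedEBall p (s : ℝ≥0∞)) := by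
  obtain ⟨δ, hδ, hcomp⟩ := hr.exists_isCompact_cthickening
  lift δ to ℝ≥0 using hδ.le
  rw [NNReal.coe_pos] at hδ
  exact ⟨r + δ / 2, lt_add_of_pos_right r (half_pos hδ), hcomp.of_isClosed_subset
    isClosed_closedEBall ((hX.closedEBall_subset_thickening p hδ
      (add_lt_add_right (half_lt_self hδ) r)).trans (thickening_subset_cthickening _ _))⟩

variable [CompleteSpace X]

theorem isClosed_setOf_isCompact_closedEBall (hX : IsLengthSpace X) (p : X) :
    IsClosed {r : ℝ≥0 | IsCompact (closedEBall p r)} := by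
  refine isClosed_of_closure_subset fun r hr => ?_
  refine (totallyBounded_of_forall_subset_thickening fun δ hδ => ?_).isCompact_of_isClosed
    isClosed_closedEBall
  obtain ⟨s, hs, hrs⟩ := Metric.mem_closure_iff.1 hr δ hδ
  lift δ to ℝ≥0 using hδ.le
  have hlt : r < s + δ := by
    rw [NNReal.dist_eq, abs_lt] at hrs
    rw [← NNReal.coe_lt_coe, NNReal.coe_add]
    linarith
  exact ⟨_, IsCompact.totallyBounded hs, hX.closedEBall_subset_thickening p (by simpa using hδ) hlt⟩

theorem isCompact_closedEBall [LocallyCompactSpace X] (hX : IsLengthSpace X) (p : X) (R : ℝ≥0) :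
    IsCompact (closedEBall p (R : ℝ≥0∞)) := by
  have hmono : ∀ {r s : ℝ≥0}, r ≤ s → IsCompact (closedEBall p (s : ℝ≥0∞)) →
      IsCompact (closedEBall p (r : ℝ≥0∞)) := fun hrs hs =>
    hs.of_isClosed_subset isClosed_closedEBall
      (closedEBall_subset_closedEBall (by exact_mod_cast hrs))
  refine ((hX.isClosed_setOf_isCompact_closedEBall p).inter
    isClosed_Icc).Icc_subset_of_forall_exists_gt ?_ (fun r hr t ht => ?_)
    (right_mem_Icc.2 (zero_le (a := R)))
  · have hzero : closedEBall p 0 = closure {p} := by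
      ext x
      rw [mem_closure_iff_infEDist_zero, infEDist_singleton, mem_closedEBall, nonpos_iff_eq_zero]
    rw [mem_ofPred_eq, ENNReal.coe_zero, hzero]
    exact isCompact_singleton.closure
  · obtain ⟨s, hrs, hs⟩ := hX.exists_gt_isCompact_closedEBall hr.1
    exact ⟨min s t, hmono (min_le_left s t) hs, lt_min hrs ht, min_le_right s t⟩

end IsLengthSpace

theorem isLengthSpace_of_isRiemannianManifold {E H M : Type*} [NormedAddCommGroup E]
    [NormedSpace ℝ E] [TopologicalSpace H] (I : ModelWithCorners ℝ E H) [PseudoEMetricSpace M]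
    [ChartedSpace H M] [RiemannianBundle (fun x : M => TangentSpace I x)]
    [IsRiemannianManifold I M] : IsLengthSpace M := by
  intro x y r s hs hxy
  rcases le_or_gt (edist x y) r with hle | hgt
  · exact ⟨y, hle, by rwa [edist_self]⟩
  rw [IsRiemannianManifold.out (I := I) x y] at hxy
  obtain ⟨γ, h0, h1, hγ, hlength⟩ := exists_lt_of_riemannianEDist_lt hxy
  have hcont : ContinuousOn (fun t => edist x (γ t)) (Icc 0 1) :=
    (continuous_const.edist continuous_id).comp_continuousOn hγ.continuousOn
  obtain ⟨t, ht, hxt : edist x (γ t) = r⟩ := intermediate_value_Icc zero_le_one hcont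
    (show r ∈ Icc _ _ by simp [h0, h1, hgt.le])
  have hinitial : r ≤ pathELength I γ 0 t := by
    rw [← hxt, IsRiemannianManifold.out (I := I)]
    exact riemannianEDist_le_pathELength (hγ.mono (Icc_subset_Icc le_rfl ht.2)) h0 rfl ht.1
  have hfinal : edist (γ t) y ≤ pathELength I γ t 1 := by
    rw [IsRiemannianManifold.out (I := I)]
    exact riemannianEDist_le_pathELength (hγ.mono (Icc_subset_Icc ht.1 le_rfl)) rfl h1 ht.2
  refine ⟨γ t, hxt.le, lt_of_add_lt_add_left (a := r) ?_⟩
  calc r + edist (γ t) y ≤ pathELength I γ 0 t + pathELength I γ t 1 := add_le_add hinitial hfinal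
    _ = pathELength I γ 0 1 := pathELength_add ht.1 ht.2
    _ < r + s := hlength

theorem IsRiemannianComplete.isCompact_setOf_riemannianEDist_le {q : ℕ} {B : Type*}
    [TopologicalSpace B] [T2Space B] [ChartedSpace (Eu q) B] [IsManifold (𝓡 q) 1 B]
    [RiemannianBundle (fun b : B => TangentSpace (𝓡 q) b)]
    [IsContinuousRiemannianBundle (Eu q) (fun b : B => TangentSpace (𝓡 q) b)]
    (hB : IsRiemannianComplete q B) (p : B) (R : ℝ≥0) :
    IsCompact {b | riemannianEDist (𝓡 q) p b ≤ R} := by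
  have : LocallyCompactSpace B := ChartedSpace.locallyCompactSpace (Eu q) B
  let : EMetricSpace B := .ofRiemannianMetric (𝓡 q) B
  have : CompleteSpace B := EMetric.complete_of_cauchySeq_tendsto fun u hu =>
    hB u (EMetric.cauchySeq_iff.1 hu)
  have hball : {b | riemannianEDist (𝓡 q) p b ≤ R} = closedEBall p (R : ℝ≥0∞) := by
    ext b
    exact (mem_closedEBall' (x := p) (y := b) (ε := R)).symm
  rw [hball]
  exact (isLengthSpace_of_isRiemannianManifold (M := B) (𝓡 q)).isCompact_closedEBall p R

end LengthSpace

section ProperMap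

variable {X Y : Type*} [TopologicalSpace X] [TopologicalSpace Y]

theorem subset_interior_of_disjoint_frontier {s t : Set X}
    (hs : IsPreconnected s) (hst : Disjoint s (frontier t)) (hne : (s ∩ interior t).Nonempty) :
    s ⊆ interior t := by
  refine hs.subset_left_of_subset_union isOpen_interior isClosed_closure.isOpen_compl
    (disjoint_compl_right.mono_left interior_subset_closure) (fun x hx => ?_) hne
  by_contra hcon
  rw [mem_union, not_or, mem_compl_iff, not_not] at hcon
  exact disjoint_left.1 hst hx ⟨hcon.2, hcon.1⟩

theorem isProperMap_of_isQuotientMap [T2Space X] [LocallyCompactSpace X] [T2Space Y] {f : X → Y}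
    (hf : IsQuotientMap f) (hcomp : ∀ y, IsCompact (f ⁻¹' {y}))
    (hconn : ∀ y, IsPreconnected (f ⁻¹' {y})) : IsProperMap f := by
  refine isProperMap_iff_isClosedMap_and_compact_fibers.2 ⟨hf.continuous, fun C hC => ?_, hcomp⟩
  rw [← isOpen_compl_iff, ← hf.isOpen_preimage, isOpen_iff_mem_nhds]
  intro x hx
  have hfiber : f ⁻¹' {f x} ⊆ Cᶜ := fun z hz hzC => hx ⟨z, hzC, hz⟩
  obtain ⟨L, hL, hxL, hLC⟩ := exists_compact_between (hcomp (f x)) hC.isOpen_compl hfiber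
  have hfrontier : IsClosed (f '' frontier L) :=
    ((hL.of_isClosed_subset isClosed_frontier hL.isClosed.frontier_subset).image
      hf.continuous).isClosed
  have hx_frontier : f x ∉ f '' frontier L := fun ⟨z, hz, hzx⟩ => hz.2 (hxL hzx)
  filter_upwards [isOpen_interior.mem_nhds (hxL rfl),
    (hfrontier.isOpen_compl.preimage hf.continuous).mem_nhds hx_frontier] with z hzL hz
  have hzfiber : f ⁻¹' {f z} ⊆ interior L :=
    subset_interior_of_disjoint_frontier (hconn (f z))
      (disjoint_left.2 fun w hw hwL => hz ⟨w, hwL, hw⟩) ⟨z, rfl, hzL⟩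
  rintro ⟨w, hwC, hw⟩
  exact hLC (interior_subset (hzfiber hw)) hwC

end ProperMap

section Velocity

variable {m n : ℕ} {M N : Type*} [TopologicalSpace M] [ChartedSpace (Eu m) M]
  [TopologicalSpace N] [ChartedSpace (Eu n) N] {γ : ℝ → M}

theorem velocity_comp {f : M → N} {t : ℝ} (ht : t ∈ Icc (0 : ℝ) 1)
    (hf : MDifferentiableAt (𝓡 m) (𝓡 n) f (γ t))
    (hγ : MDifferentiableWithinAt 𝓘(ℝ, ℝ) (𝓡 m) γ (Icc 0 1) t) :
    velocity n (f ∘ γ) t = mfderiv (𝓡 m) (𝓡 n) f (γ t) (velocity m γ t) := by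
  have huniq : UniqueMDiffWithinAt 𝓘(ℝ, ℝ) (Icc (0 : ℝ) 1) t :=
    (uniqueDiffOn_Icc zero_lt_one t ht).uniqueMDiffWithinAt
  exact congrArg (fun A => A (1 : ℝ)) (mfderiv_comp_mfderivWithin t hf hγ huniq)

theorem velocity_comp_mul_left {a t : ℝ} (ha : a ∈ Icc (0 : ℝ) 1) (ht : t ∈ Icc (0 : ℝ) 1)
    (hγ : MDifferentiableWithinAt 𝓘(ℝ, ℝ) (𝓡 m) γ (Icc 0 1) (a * t)) :
    velocity m (fun s => γ (a * s)) t = a • velocity m γ (a * t) := by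
  have huniq : UniqueDiffWithinAt ℝ (Icc (0 : ℝ) 1) t := uniqueDiffOn_Icc zero_lt_one t ht
  have hmul : DifferentiableWithinAt ℝ (fun s : ℝ => a * s) (Icc 0 1) t := by fun_prop
  have hmaps : MapsTo (fun s : ℝ => a * s) (Icc 0 1) (Icc 0 1) := fun s hs =>
    unitInterval.mul_mem ha hs
  have hchain := mfderivWithin_comp t hγ hmul.mdifferentiableWithinAt hmaps
    huniq.uniqueMDiffWithinAt
  have hderiv : mfderivWithin 𝓘(ℝ, ℝ) 𝓘(ℝ, ℝ) (fun s : ℝ => a * s) (Icc 0 1) t (1 : ℝ) =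
      a • (1 : ℝ) := by
    rw [mfderivWithin_eq_fderivWithin]
    exact ((hasDerivAt_id t).const_mul a).hasDerivWithinAt.derivWithin huniq
  calc velocity m (fun s => γ (a * s)) t
      = mfderivWithin 𝓘(ℝ, ℝ) (𝓡 m) γ (Icc 0 1) (a * t)
          (mfderivWithin 𝓘(ℝ, ℝ) 𝓘(ℝ, ℝ) (fun s : ℝ => a * s) (Icc 0 1) t (1 : ℝ)) :=
        congrArg (fun A => A (1 : ℝ)) hchain
    _ = mfderivWithin 𝓘(ℝ, ℝ) (𝓡 m) γ (Icc 0 1) (a * t) (a • (1 : ℝ)) := congrArg _ hderiv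
    _ = a • velocity m γ (a * t) := map_smul _ a (1 : ℝ)

end Velocity

section Leaves

variable {m : ℕ} {M : Type*} [TopologicalSpace M] [ChartedSpace (Eu m) M]
  {D : ∀ x : M, Submodule ℝ (TangentSpace (𝓡 m) x)} {x y : M}

theorem isQuotientMap_leafProj (D : ∀ x : M, Submodule ℝ (TangentSpace (𝓡 m) x)) :
    IsQuotientMap (leafProj D) :=
  isQuotientMap_quotient_mk'

theorem leafProj_eq_iff : leafProj D x = leafProj D y ↔ y ∈ leaf D x :=
  Quotient.eq

theorem leafProj_preimage_singleton (D : ∀ x : M, Submodule ℝ (TangentSpace (𝓡 m) x)) (x : M) :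
    leafProj D ⁻¹' {leafProj D x} = leaf D x := by
  ext y
  rw [mem_preimage, mem_singleton_iff, eq_comm, leafProj_eq_iff]

theorem leaf_eq_leaf (h : y ∈ leaf D x) : leaf D y = leaf D x := by
  rw [← leafProj_preimage_singleton, ← leafProj_preimage_singleton, leafProj_eq_iff.2 h]

theorem tangentArc_apply_of_mem_Icc {γ : ℝ → M} (hγ : IsC1Curve m γ x y)
    (hD : ∀ t ∈ Icc (0 : ℝ) 1, velocity m γ t ∈ D (γ t)) {a : ℝ} (ha : a ∈ Icc (0 : ℝ) 1) :
    TangentArc D x (γ a) := by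
  have hmaps : MapsTo (fun s : ℝ => a * s) (Icc 0 1) (Icc 0 1) := fun s hs =>
    unitInterval.mul_mem ha hs
  have hmul : ContMDiff 𝓘(ℝ, ℝ) 𝓘(ℝ, ℝ) 1 (fun s : ℝ => a * s) :=
    (contDiff_const.mul contDiff_id).contMDiff
  refine ⟨fun s => γ (a * s), ⟨hγ.contMDiffOn.comp hmul.contMDiffOn hmaps, ?_, ?_⟩, fun t ht => ?_⟩
  · rw [mul_zero, hγ.source]
  · rw [mul_one]
  · rw [velocity_comp_mul_left ha ht
      ((hγ.contMDiffOn _ (hmaps ht)).mdifferentiableWithinAt one_ne_zero)]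
    exact Submodule.smul_mem _ _ (hD _ (hmaps ht))

theorem TangentArc.exists_isPreconnected_subset_leaf (h : TangentArc D x y) :
    ∃ s ⊆ leaf D x, x ∈ s ∧ y ∈ s ∧ IsPreconnected s := by
  obtain ⟨γ, hγ, hD⟩ := h
  refine ⟨γ '' Icc 0 1, ?_, ⟨0, unitInterval.zero_mem, hγ.source⟩,
    ⟨1, unitInterval.one_mem, hγ.target⟩, isPreconnected_Icc.image _ hγ.contMDiffOn.continuousOn⟩
  rintro _ ⟨t, ht, rfl⟩
  exact .rel _ _ (tangentArc_apply_of_mem_Icc hγ hD ht)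

theorem isPreconnected_leaf (D : ∀ x : M, Submodule ℝ (TangentSpace (𝓡 m) x)) (x : M) :
    IsPreconnected (leaf D x) := by
  refine isPreconnected_of_forall x fun y (hy : Relation.EqvGen (TangentArc D) x y) => ?_
  induction hy with
  | rel x y h => exact h.exists_isPreconnected_subset_leaf
  | refl x =>
    exact ⟨{x}, singleton_subset_iff.2 (.refl x), rfl, rfl, isPreconnected_singleton⟩
  | symm x y h ih =>
    obtain ⟨s, hsub, hx, hy, hs⟩ := ih
    exact ⟨s, by rwa [leaf_eq_leaf h], hy, hx, hs⟩
  | trans x y z hxy _ ih ih' =>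
    obtain ⟨s, hsub, hx, hy, hs⟩ := ih
    obtain ⟨s', hsub', hy', hz, hs'⟩ := ih'
    exact ⟨s ∪ s', union_subset hsub (by rwa [← leaf_eq_leaf hxy]), .inl hx, .inr hz,
      hs.union y hy hy' hs'⟩

theorem isProperMap_leafProj [T2Space M] [T2Space (LeafSpace D)]
    (hleaf : ∀ x, IsCompact (leaf D x)) : IsProperMap (leafProj D) := by
  have : LocallyCompactSpace M := ChartedSpace.locallyCompactSpace (Eu m) M
  refine isProperMap_of_isQuotientMap (isQuotientMap_leafProj D)
    ((isQuotientMap_leafProj D).surjective.forall.2 fun x => ?_)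
    ((isQuotientMap_leafProj D).surjective.forall.2 fun x => ?_)
  · rw [leafProj_preimage_singleton]
    exact hleaf x
  · rw [leafProj_preimage_singleton]
    exact isPreconnected_leaf D x

end Leaves

section BoundedSets

variable {m q : ℕ} {U : Type*} [TopologicalSpace U] [ChartedSpace (Eu (m + 1)) U]
  [IsManifold (𝓡 (m + 1)) ∞ U] {g : LorentzianMetric m U} {Φ : U → ℝ}
  [ChartedSpace (Eu m) (Hypersurface Φ)] {B : Type*} [TopologicalSpace B] [ChartedSpace (Eu q) B]
  [RiemannianBundle (fun b : B => TangentSpace (𝓡 q) b)] {f : Hypersurface Φ → B}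

variable (q g f) in
/-- `g^M` descends along `f : M → B` to the Riemannian metric `g_B` of `B`, i.e. `f^* g_B = g^M`.
For the projection `f` onto the leaf space, `g_B` is the reduced metric. The derivative of `f` is
`mfderiv`, so this is meant for differentiable `f`. -/
def InducedFormDescends : Prop :=
  ∀ (x : Hypersurface Φ) (v w : TangentSpace (𝓡 m) x),
    inner ℝ (mfderiv (𝓡 m) (𝓡 q) f x v) (mfderiv (𝓡 m) (𝓡 q) f x w) = inducedForm g Φ x v w

namespace InducedFormDescends

theorem inducedForm_self_nonneg (h : InducedFormDescends q g f) (x : Hypersurface Φ)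
    (v : TangentSpace (𝓡 m) x) : 0 ≤ inducedForm g Φ x v v := by
  rw [← h]
  exact real_inner_self_nonneg

theorem enorm_mfderiv (h : InducedFormDescends q g f) (x : Hypersurface Φ)
    (v : TangentSpace (𝓡 m) x) :
    ‖mfderiv (𝓡 m) (𝓡 q) f x v‖ₑ = ENNReal.ofReal (√(inducedForm g Φ x v v)) := by
  rw [← h, ← norm_eq_sqrt_real_inner, ofReal_norm]

theorem pathELength_comp (h : InducedFormDescends q g f) (hf : MDifferentiable (𝓡 m) (𝓡 q) f)
    {γ : ℝ → Hypersurface Φ} (hγ : MDifferentiableOn 𝓘(ℝ, ℝ) (𝓡 m) γ (Icc 0 1)) :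
    pathELength (𝓡 q) (f ∘ γ) 0 1 = inducedLength g Φ γ := by
  rw [pathELength_eq_lintegral_mfderivWithin_Icc, inducedLength]
  refine setLIntegral_congr_fun measurableSet_Icc fun t ht => ?_
  calc ‖velocity q (f ∘ γ) t‖ₑ = ‖mfderiv (𝓡 m) (𝓡 q) f (γ t) (velocity m γ t)‖ₑ :=
        congrArg (fun w : TangentSpace (𝓡 q) (f (γ t)) => ‖w‖ₑ) (velocity_comp ht (hf _) (hγ t ht))
    _ = _ := h.enorm_mfderiv _ _

theorem riemannianEDist_le_inducedEDist (h : InducedFormDescends q g f)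
    (hf : ContMDiff (𝓡 m) (𝓡 q) 1 f) (x y : Hypersurface Φ) :
    riemannianEDist (𝓡 q) (f x) (f y) ≤ inducedEDist g Φ x y :=
  le_iInf₂ fun γ hγ => by
    rw [← h.pathELength_comp (hf.mdifferentiable one_ne_zero)
      (hγ.contMDiffOn.mdifferentiableOn one_ne_zero)]
    exact riemannianEDist_le_pathELength (hf.comp_contMDiffOn hγ.contMDiffOn)
      (congrArg f hγ.source) (congrArg f hγ.target) zero_le_one

end InducedFormDescends

theorem IsBoundedSet.exists_isCompact_superset [T2Space B] [IsManifold (𝓡 q) 1 B]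
    [IsContinuousRiemannianBundle (Eu q) (fun b : B => TangentSpace (𝓡 q) b)]
    {s : Set (Hypersurface Φ)} (hs : IsBoundedSet g Φ s) (hB : IsRiemannianComplete q B)
    (hf : ContMDiff (𝓡 m) (𝓡 q) 1 f) (hproper : IsProperMap f)
    (hdescends : InducedFormDescends q g f) : ∃ K, IsCompact K ∧ s ⊆ K := by
  obtain ⟨F, R, hF⟩ := hs
  have hballs : IsCompact (⋃ p ∈ F, {b | riemannianEDist (𝓡 q) (f p) b ≤ R}) :=
    F.isCompact_biUnion fun p _ => hB.isCompact_setOf_riemannianEDist_le (f p) R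
  refine ⟨_, hproper.isCompact_preimage hballs, fun x hx => ?_⟩
  obtain ⟨p, hp, hpx⟩ := hF x hx
  exact mem_iUnion₂.2 ⟨p, hp, (hdescends.riemannianEDist_le_inducedEDist hf p x).trans hpx⟩

end BoundedSets

section Lyapunov

variable {m : ℕ} {M : Type*} [TopologicalSpace M] [ChartedSpace (Eu m) M]
  {V : ∀ x : M, TangentSpace (𝓡 m) x} {Ψ : M → ℝ} {γ : ℝ → M} {s : Set ℝ}

theorem hasDerivWithinAt_comp_of_isMIntegralCurveOn {t : ℝ}
    (hΨ : MDifferentiableAt (𝓡 m) 𝓘(ℝ, ℝ) Ψ (γ t)) (hγ : IsMIntegralCurveOn (I := 𝓡 m) γ V s)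
    (ht : t ∈ s) : HasDerivWithinAt (Ψ ∘ γ) (differential Ψ (γ t) (V (γ t))) s t := by
  have hderiv : HasFDerivWithinAt (Ψ ∘ γ) (ContinuousLinearMap.comp
      (mfderiv (𝓡 m) 𝓘(ℝ, ℝ) Ψ (γ t)) ((1 : ℝ →L[ℝ] ℝ).smulRight (V (γ t))) : ℝ →L[ℝ] ℝ) s t :=
    (hΨ.hasMFDerivAt.comp_hasMFDerivWithinAt t (hγ t ht)).hasFDerivWithinAt
  exact hderiv.hasDerivWithinAt.congr_deriv
    (congrArg (mfderiv (𝓡 m) 𝓘(ℝ, ℝ) Ψ (γ t)) (one_smul ℝ (V (γ t))))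

theorem antitoneOn_comp_of_isMIntegralCurveOn (hs : Convex ℝ s)
    (hΨ : MDifferentiable (𝓡 m) 𝓘(ℝ, ℝ) Ψ) (hV : ∀ x, differential Ψ x (V x) ≤ 0)
    (hγ : IsMIntegralCurveOn (I := 𝓡 m) γ V s) : AntitoneOn (Ψ ∘ γ) s :=
  have hderiv : ∀ t ∈ s, HasDerivWithinAt (Ψ ∘ γ) (differential Ψ (γ t) (V (γ t))) s t :=
    fun _ ht => hasDerivWithinAt_comp_of_isMIntegralCurveOn (hΨ _) hγ ht
  antitoneOn_of_hasDerivWithinAt_nonpos hs (fun t ht => (hderiv t ht).continuousWithinAt)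
    (fun t ht => (hderiv t (interior_subset ht)).mono interior_subset) fun _ _ => hV _

theorem isAsymptoticallyCompact_of_sublevel {X : Type*} [TopologicalSpace X]
    [FirstCountableTopology X] {bounded : Set X → Prop} {φ : ℝ → X → X} {Ψ : X → ℝ}
    (hcompact : ∀ s, bounded s → ∃ K, IsCompact K ∧ s ⊆ K) (hΨ : Continuous Ψ)
    (hsublevel : ∀ a, bounded {x | Ψ x ≤ a}) (hφ : ∀ x, ∀ t ≥ 0, Ψ (φ t x) ≤ Ψ x) :
    IsAsymptoticallyCompact bounded φ := by
  intro x t hx ht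
  obtain ⟨K, hK, hxK⟩ := hcompact _ hx
  obtain ⟨a, ha⟩ := hK.bddAbove_image hΨ.continuousOn
  obtain ⟨L, hL, hΨL⟩ := hcompact _ (hsublevel a)
  have hmem : ∀ᶠ n in atTop, φ (t n) (x n) ∈ L := by
    filter_upwards [ht.eventually_ge_atTop 0] with n hn
    exact hΨL ((hφ _ _ hn).trans (ha (mem_image_of_mem Ψ (hxK (mem_range_self n)))))
  obtain ⟨y, -, σ, hσ, hlim⟩ := hL.tendsto_subseq' hmem.frequently
  exact ⟨σ, y, hσ, hlim⟩

end Lyapunov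

theorem IsDissipativeFunctional.differential_nonpos {m : ℕ} {U : Type*} [TopologicalSpace U]
    [ChartedSpace (Eu (m + 1)) U] [IsManifold (𝓡 (m + 1)) ∞ U] {g : LorentzianMetric m U}
    {Φ : U → ℝ} [ChartedSpace (Eu m) (Hypersurface Φ)] [IsManifold (𝓡 m) ∞ (Hypersurface Φ)]
    {S : ∀ x : Hypersurface Φ, Submodule ℝ (TangentSpace (𝓡 m) x)}
    {hS : IsTransversalComplement g Φ S} {V : ∀ x : Hypersurface Φ, TangentSpace (𝓡 m) x}
    {Ψ : Hypersurface Φ → ℝ} (hΨ : IsDissipativeFunctional hS V Ψ) {x : Hypersurface Φ}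
    (hnonneg : ∀ v, 0 ≤ inducedForm g Φ x v v) : differential Ψ x (V x) ≤ 0 := by
  obtain ⟨c, hc, hdiss⟩ := hΨ.dissipation
  have hnull : V x - transversalPart hS V x ∈ nullDistribution g Φ x := by
    rw [← Submodule.projectionOnto_apply_eq_zero_iff (hS.isCompl x), map_sub, sub_eq_zero]
    exact (Submodule.projectionOnto_apply_left (hS.isCompl x) _).symm
  have hdiff : differential Ψ x (V x) = differential Ψ x (transversalPart hS V x) :=
    sub_eq_zero.1 ((map_sub (mfderiv (𝓡 m) 𝓘(ℝ, ℝ) Ψ x) _ _).symm.trans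
      (hΨ.compatible x _ hnull))
  rw [hdiff]
  exact (hdiss x).trans (neg_nonpos.2 (mul_nonneg hc.le (hnonneg _)))

theorem firstCountableTopology_of_chartedSpace (H M : Type*) [TopologicalSpace H]
    [FirstCountableTopology H] [TopologicalSpace M] [ChartedSpace H M] :
    FirstCountableTopology M where
  nhds_generated_countable x := by
    rw [← (chartAt H x).symm_map_nhds_eq (mem_chart_source H x)]
    infer_instance

theorem isContinuousRiemannianBundle_of_isContMDiffRiemannianBundle {E H B F : Type*}
    [NormedAddCommGroup E] [NormedSpace ℝ E] [TopologicalSpace H] (I : ModelWithCorners ℝ E H)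
    (n : ℕ∞ω) [TopologicalSpace B] [ChartedSpace H B] [NormedAddCommGroup F] [NormedSpace ℝ F]
    {W : B → Type*} [TopologicalSpace (TotalSpace F W)] [∀ b, NormedAddCommGroup (W b)]
    [∀ b, InnerProductSpace ℝ (W b)] [FiberBundle F W] [VectorBundle ℝ F W]
    [IsContMDiffRiemannianBundle I n F W] : IsContinuousRiemannianBundle F W := by
  obtain ⟨g, hg, hinner⟩ :=
    IsContMDiffRiemannianBundle.exists_contMDiff (IB := I) (n := n) (F := F) (E := W)
  exact ⟨g, hg.continuous, hinner⟩

theorem theorem1_general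
    {m q : ℕ} {U : Type*} [TopologicalSpace U] [ChartedSpace (Eu (m + 1)) U]
    [IsManifold (𝓡 (m + 1)) ∞ U] (g : LorentzianMetric m U) (Φ : U → ℝ)
    [ChartedSpace (Eu m) (Hypersurface Φ)] [IsManifold (𝓡 m) ∞ (Hypersurface Φ)]
    [T2Space (Hypersurface Φ)]
    (hemb : IsSmoothEmbedding (𝓡 m) (𝓡 (m + 1)) ∞ (Subtype.val : Hypersurface Φ → U))
    (S : ∀ x : Hypersurface Φ, Submodule ℝ (TangentSpace (𝓡 m) x))
    (hS : IsTransversalComplement g Φ S)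
    (hleaf : ∀ x : Hypersurface Φ, IsCompact (leaf (nullDistribution g Φ) x))
    [T2Space (ReducedSpace g Φ)] [ChartedSpace (Eu q) (ReducedSpace g Φ)]
    [IsManifold (𝓡 q) 1 (ReducedSpace g Φ)]
    (hπ : ContMDiff (𝓡 m) (𝓡 q) 1 (leafProj (nullDistribution g Φ)))
    [RiemannianBundle (fun b : ReducedSpace g Φ => TangentSpace (𝓡 q) b)]
    [IsContinuousRiemannianBundle (Eu q)
      (fun b : ReducedSpace g Φ => TangentSpace (𝓡 q) b)]
    (hred : InducedFormDescends q g (leafProj (nullDistribution g Φ)))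
    (hcomplete : IsRiemannianComplete q (ReducedSpace g Φ))
    (V : ∀ x : Hypersurface Φ, TangentSpace (𝓡 m) x)
    (φ : ℝ → Hypersurface Φ → Hypersurface Φ) (hφ₀ : ∀ x, φ 0 x = x)
    (hφ : ∀ x, IsMIntegralCurveOn (I := 𝓡 m) (fun t => φ t x) V (Ici 0))
    (hΨ : ∃ Ψ : Hypersurface Φ → ℝ, IsDissipativeFunctional hS V Ψ) :
    IsAsymptoticallyCompact (IsBoundedSet g Φ) φ := by
  obtain ⟨Ψ, hΨ⟩ := hΨ
  have : FirstCountableTopology (Hypersurface Φ) :=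
    firstCountableTopology_of_chartedSpace (Eu m) (Hypersurface Φ)
  refine isAsymptoticallyCompact_of_sublevel (fun s hs => ?_) hΨ.contMDiff.continuous hΨ.proper
    fun x t ht => ?_
  · exact hs.exists_isCompact_superset hcomplete hπ (isProperMap_leafProj hleaf) hred
  · have hanti := antitoneOn_comp_of_isMIntegralCurveOn (convex_Ici 0)
      (hΨ.contMDiff.mdifferentiable one_ne_zero)
      (fun y => hΨ.differential_nonpos (hred.inducedForm_self_nonneg y)) (hφ x)
    simpa only [Function.comp_apply, hφ₀] using hanti self_mem_Ici ht ht

theorem theorem1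
    {m k q : ℕ} (hk : 1 ≤ k)
    -- the ambient Lorentzian phase space, of dimension `n = m + 1`
    {U : Type*} [TopologicalSpace U] [T2Space U] [SecondCountableTopology U]
    [ChartedSpace (Eu (m + 1)) U] [IsManifold (𝓡 (m + 1)) ∞ U]
    (g : LorentzianMetric m U)
    -- the constraint hypersurface `M = Φ⁻¹(0)`, with its structure of embedded submanifold
    (Φ : U → ℝ) (hΦ : ContMDiff (𝓡 (m + 1)) 𝓘(ℝ, ℝ) ∞ Φ)
    (hreg : ∀ x : U, Φ x = 0 → mfderiv (𝓡 (m + 1)) 𝓘(ℝ, ℝ) Φ x ≠ 0)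
    [ChartedSpace (Eu m) (Hypersurface Φ)] [IsManifold (𝓡 m) ∞ (Hypersurface Φ)]
    (hemb : IsSmoothEmbedding (𝓡 m) (𝓡 (m + 1)) ∞ (Subtype.val : Hypersurface Φ → U))
    -- the null distribution has constant rank `k`, is involutive, and has a complement `S`
    (hcorank : ∀ x : Hypersurface Φ, Module.finrank ℝ (nullDistribution g Φ x) = k)
    (hinv : IsInvolutive (nullDistribution g Φ))
    (S : ∀ x : Hypersurface Φ, Submodule ℝ (TangentSpace (𝓡 m) x))
    (hS : IsTransversalComplement g Φ S)
    -- the leaves are compact, and the leaf space `M_red` is a Hausdorff manifold for which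
    -- the projection is a submersion (so that the leaves are embedded)
    (hleaf : ∀ x : Hypersurface Φ, IsCompact (leaf (nullDistribution g Φ) x))
    [T2Space (ReducedSpace g Φ)] [ChartedSpace (Eu q) (ReducedSpace g Φ)]
    [IsManifold (𝓡 q) ∞ (ReducedSpace g Φ)]
    (hπ : IsSubmersion (𝓡 m) (𝓡 q) ∞ (leafProj (nullDistribution g Φ)))
    -- the Riemannian metric induced on `M_red` by `g^M`; it is complete
    [RiemannianBundle (fun b : ReducedSpace g Φ => TangentSpace (𝓡 q) b)]
    [IsContMDiffRiemannianBundle (𝓡 q) ∞ (Eu q)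
      (fun b : ReducedSpace g Φ => TangentSpace (𝓡 q) b)]
    (hred : ∀ (x : Hypersurface Φ) (v w : TangentSpace (𝓡 m) x),
      inner ℝ (mfderiv (𝓡 m) (𝓡 q) (leafProj (nullDistribution g Φ)) x v)
        (mfderiv (𝓡 m) (𝓡 q) (leafProj (nullDistribution g Φ)) x w) = inducedForm g Φ x v w)
    (hcomplete : IsRiemannianComplete q (ReducedSpace g Φ))
    -- the intrinsic vector field, which preserves the null foliation, and its semiflow
    (V : ∀ x : Hypersurface Φ, TangentSpace (𝓡 m) x) (hV : IsVectorFieldOfClass 2 V)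
    (hproj : PreservesDistribution V (nullDistribution g Φ))
    (φ : ℝ → Hypersurface Φ → Hypersurface Φ) (hφ : IsClosedSemiflow V φ)
    -- the null-compatible functional
    (hΨ : ∃ Ψ : Hypersurface Φ → ℝ, IsDissipativeFunctional hS V Ψ) :
    IsAsymptoticallyCompact (IsBoundedSet g Φ) φ := by
  have := isContinuousRiemannianBundle_of_isContMDiffRiemannianBundle (𝓡 q) ∞ (F := Eu q)
    (W := fun b : ReducedSpace g Φ => TangentSpace (𝓡 q) b)
  exact theorem1_general g Φ hemb S hS hleaf (hπ.contMDiff.of_le (by simp)) hred hcomplete V φ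
    hφ.map_zero hφ.integralCurve hΨ
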